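/- Let $(X,d)$ be a Polish metric space (i.e. complete and separable), let $p\ge 1$ be an integer, and let $G$ be a subgroup of the group $\mathrm{ISO}(X)$ of bijective isometries of $X$. Let $P_p(X)$ be the set of Borel probability measures $\mu$ on $X$ with $\int d(x_0,x)^p\,d\mu(x)<\infty$ for some $x_0\in X$, and let $$W_p(\mu,\nu)=\Big(\inf_{\pi}\int_{X\times X} d(x,y)^p\,d\pi(x,y)\Big)^{1/p}$$ be the Wasserstein distance on $P_p(X)$, where $\pi$ ranges over the measures on $X\times X$ with marginals $\mu$ and $\nu$. The group $G$ acts on $P_p(X)$ by push-forward, $g\mu:=g_\#\mu$. Let the shape space $\mathrm{Sh}_p(X)$ be the quotient of $P_p(X)$ by the equivalence relation $\mu\sim\nu\iff\exists\, g\in G:\ \mu=g\nu$, and let $$D_p([\mu],[\nu]):=\inf_{g\in G}W_p(g\mu,\nu)$$ be the shape distance (this is well defined on classes). Assume that at least one of the following holds: (a) $X$ is a proper metric space (closed bounded sets are compact) and $G$ carries a topology for which it acts properly on $X$, i.e. the map $G\times X\to X\times X$, $(g,x)\mapsto(gx,x)$, is continuous and proper; (b) for all $\mu,\nu\in P_p(X)$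 the infimum $\inf_{g\in G}W_p(g\mu,\nu)$ is attained. Then $D_p$ is a metric on $\mathrm{Sh}_p(X)$, and the metric space $(\mathrm{Sh}_p(X),D_p)$ is complete and separable; that is, $\mathrm{Sh}_p(X)$ is a Polish space. -/

import Mathlib

open MeasureTheory
open scoped ENNReal

namespace ShapeSpace

/-- The `p`-th moment of `μ` is finite: `∫ d(x₀, x)^p dμ(x) < ∞` for some `x₀`. -/
def HasFiniteMoment {X : Type*} [MetricSpace X] [MeasurableSpace X] (p : ℕ) (μ : Measure X) :
    Prop :=
  ∃ x₀ : X, ∫⁻ x, edist x₀ x ^ p ∂μ < ∞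

/-- The set `P_p(X)` of Borel probability measures on `X` with finite `p`-th moment. -/
structure FiniteMomentMeasure (p : ℕ) (X : Type*) [MetricSpace X] [MeasurableSpace X] where
  /-- the underlying measure -/
  toMeasure : Measure X
  isProbabilityMeasure : IsProbabilityMeasure toMeasure
  hasFiniteMoment : HasFiniteMoment p toMeasure

theorem FiniteMomentMeasure.ext {p : ℕ} {X : Type*} [MetricSpace X] [MeasurableSpace X]
    {μ ν : FiniteMomentMeasure p X} (h : μ.toMeasure = ν.toMeasure) : μ = ν := by
  cases μ; cases ν; cases h; rfl

/-- The set `Adm(μ, ν)` of couplings (admissible transport plans): measures on `X × X` with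
marginals `μ` and `ν`. -/
def couplings {X : Type*} [MeasurableSpace X] (μ ν : Measure X) : Set (Measure (X × X)) :=
  {π | π.map Prod.fst = μ ∧ π.map Prod.snd = ν}

/-- The optimal cost `inf_π ∫ d(x, y)^p dπ(x, y)` over all couplings of `μ` and `ν`. -/
noncomputable def transportCost {X : Type*} [MetricSpace X] [MeasurableSpace X] (p : ℕ)
    (μ ν : Measure X) : ℝ≥0∞ :=
  ⨅ π ∈ couplings μ ν, ∫⁻ z, edist z.1 z.2 ^ p ∂π

/-- The `p`-th Wasserstein distance `W_p(μ, ν) = (inf_π ∫ d(x, y)^p dπ(x, y))^(1/p)`; the infimum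
is finite for measures with finite `p`-th moments. -/
noncomputable def wassersteinDist {p : ℕ} {X : Type*} [MetricSpace X] [MeasurableSpace X]
    (μ ν : FiniteMomentMeasure p X) : ℝ :=
  (transportCost p μ.toMeasure ν.toMeasure ^ (1 / (p : ℝ))).toReal

/-- The tautological action of the isometry group of `X` on `X`. -/
instance isometryAction {X : Type*} [MetricSpace X] : MulAction (X ≃ᵢ X) X where
  smul g x := g x
  one_smul _ := rfl
  mul_smul _ _ _ := rfl

/-- The action of the isometry group of `X` on `P_p(X)` by push-forward of measures. -/
noncomputable instance pushforwardAction {p : ℕ} {X : Type*} [MetricSpace X] [MeasurableSpace X]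
    [BorelSpace X] : MulAction (X ≃ᵢ X) (FiniteMomentMeasure p X) where
  smul g μ :=
    { toMeasure := μ.toMeasure.map g
      isProbabilityMeasure := by
        have := μ.isProbabilityMeasure
        exact Measure.isProbabilityMeasure_map g.continuous.measurable.aemeasurable
      hasFiniteMoment := by
        obtain ⟨x₀, hx₀⟩ := μ.hasFiniteMoment
        refine ⟨g x₀, ?_⟩
        have h := lintegral_map_equiv (μ := μ.toMeasure) (fun x => edist (g x₀) x ^ p)
          g.toHomeomorph.toMeasurableEquiv
        refine lt_of_eq_of_lt (h.trans ?_) hx₀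
        refine lintegral_congr fun x => ?_
        exact congrArg (fun r => r ^ p) (g.edist_eq x₀ x) }
  one_smul μ := FiniteMomentMeasure.ext (by
    change μ.toMeasure.map (id : X → X) = _
    exact Measure.map_id)
  mul_smul g h μ := FiniteMomentMeasure.ext (by
    change μ.toMeasure.map (g ∘ h) = (μ.toMeasure.map h).map g
    exact (Measure.map_map g.continuous.measurable h.continuous.measurable).symm)

theorem toMeasure_smul {p : ℕ} {X : Type*} [MetricSpace X] [MeasurableSpace X] [BorelSpace X]
    (g : X ≃ᵢ X) (μ : FiniteMomentMeasure p X) :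
    (g • μ).toMeasure = μ.toMeasure.map g := rfl

/-- The `p`-th shape distance `D_p(μ, ν) = inf_{g ∈ G} W_p(g μ, ν)` on `P_p(X)`. -/
noncomputable def shapeDistMeasure {p : ℕ} {X : Type*} [MetricSpace X] [MeasurableSpace X]
    [BorelSpace X] (G : Subgroup (X ≃ᵢ X)) (μ ν : FiniteMomentMeasure p X) : ℝ :=
  ⨅ g : G, wassersteinDist (g • μ) ν

theorem transportCost_map_le {p : ℕ} {X : Type*} [MetricSpace X] [MeasurableSpace X]
    [BorelSpace X] (g : X ≃ᵢ X) (μ ν : Measure X) :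
    transportCost p (μ.map g) (ν.map g) ≤ transportCost p μ ν := by
  have hg : Measurable g := g.continuous.measurable
  refine le_iInf₂ fun π hπ => ?_
  let e : X ≃ᵐ X := g.toHomeomorph.toMeasurableEquiv
  have hm : Measurable (Prod.map g g) := hg.prodMap hg
  have hmem : π.map (Prod.map g g) ∈ couplings (μ.map g) (ν.map g) := by
    constructor
    · rw [Measure.map_map measurable_fst hm, ← hπ.1, Measure.map_map hg measurable_fst]
      rfl
    · rw [Measure.map_map measurable_snd hm, ← hπ.2, Measure.map_map hg measurable_snd]
      rfl
  refine (iInf₂_le _ hmem).trans (le_of_eq ?_)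
  refine (lintegral_map_equiv (μ := π) (fun z : X × X => edist z.1 z.2 ^ p)
    (MeasurableEquiv.prodCongr e e)).trans (lintegral_congr fun z => ?_)
  exact congrArg (fun r => r ^ p) (g.edist_eq z.1 z.2)

/-- Isometries act isometrically with respect to `W_p`. -/
theorem wassersteinDist_smul_smul {p : ℕ} {X : Type*} [MetricSpace X] [MeasurableSpace X]
    [BorelSpace X] (g : X ≃ᵢ X) (μ ν : FiniteMomentMeasure p X) :
    wassersteinDist (g • μ) (g • ν) = wassersteinDist μ ν := by
  have key : ∀ (h : X ≃ᵢ X) (α β : FiniteMomentMeasure p X),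
      transportCost p (h • α).toMeasure (h • β).toMeasure
        ≤ transportCost p α.toMeasure β.toMeasure :=
    fun h α β => transportCost_map_le h α.toMeasure β.toMeasure
  have h2 := key g⁻¹ (g • μ) (g • ν)
  rw [inv_smul_smul, inv_smul_smul] at h2
  unfold wassersteinDist
  rw [le_antisymm (key g μ ν) h2]

/-- Shape space `Sh_p(X)`: the quotient of `P_p(X)` by the relation
`μ ∼ ν ↔ ∃ g ∈ G, μ = g ν`. -/
def Shape (p : ℕ) {X : Type*} [MetricSpace X] [MeasurableSpace X] [BorelSpace X]
    (G : Subgroup (X ≃ᵢ X)) : Type _ :=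
  Quotient (MulAction.orbitRel G (FiniteMomentMeasure p X))

/-- The class `[μ]` of `μ` in shape space. -/
noncomputable def Shape.mk {p : ℕ} {X : Type*} [MetricSpace X] [MeasurableSpace X] [BorelSpace X]
    (G : Subgroup (X ≃ᵢ X)) (μ : FiniteMomentMeasure p X) : Shape p G :=
  Quotient.mk (MulAction.orbitRel G (FiniteMomentMeasure p X)) μ

theorem Shape.mk_eq_mk_iff {p : ℕ} {X : Type*} [MetricSpace X] [MeasurableSpace X] [BorelSpace X]
    (G : Subgroup (X ≃ᵢ X)) (μ ν : FiniteMomentMeasure p X) :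
    Shape.mk G μ = Shape.mk G ν ↔ ∃ g : G, μ = g • ν := by
  refine Quotient.eq.trans (MulAction.orbitRel_apply.trans ?_)
  exact ⟨fun ⟨g, hg⟩ => ⟨g, hg.symm⟩, fun ⟨g, hg⟩ => ⟨g, hg.symm⟩⟩

theorem shapeDistMeasure_smul_smul {p : ℕ} {X : Type*} [MetricSpace X] [MeasurableSpace X]
    [BorelSpace X] (G : Subgroup (X ≃ᵢ X)) (a b : G) (μ ν : FiniteMomentMeasure p X) :
    shapeDistMeasure G (a • μ) (b • ν) = shapeDistMeasure G μ ν := by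
  unfold shapeDistMeasure
  refine Equiv.iInf_congr ((Equiv.mulLeft b⁻¹).trans (Equiv.mulRight a)) fun g => ?_
  have h := wassersteinDist_smul_smul (b : X ≃ᵢ X) ((b⁻¹ * g * a) • μ) ν
  rw [← Subgroup.smul_def, ← Subgroup.smul_def, smul_smul, mul_assoc, mul_inv_cancel_left,
    mul_smul] at h
  exact h.symm

/-- The shape distance `D_p([μ], [ν]) = D_p(μ, ν)` on shape space. -/
noncomputable def shapeDist {p : ℕ} {X : Type*} [MetricSpace X] [MeasurableSpace X]
    [BorelSpace X] {G : Subgroup (X ≃ᵢ X)} (s t : Shape p G) : ℝ :=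
  Quotient.liftOn₂ s t (shapeDistMeasure G) (by
    rintro μ ν μ' ν' ⟨a, rfl⟩ ⟨b, rfl⟩
    exact shapeDistMeasure_smul_smul G a b μ' ν')

theorem shapeDist_mk {p : ℕ} {X : Type*} [MetricSpace X] [MeasurableSpace X] [BorelSpace X]
    (G : Subgroup (X ≃ᵢ X)) (μ ν : FiniteMomentMeasure p X) :
    shapeDist (Shape.mk G μ) (Shape.mk G ν) = ⨅ g : G, wassersteinDist (g • μ) ν := rfl

/-- The infimum defining the shape distance is attained for every pair of measures. -/
def MinimizersExist (p : ℕ) {X : Type*} [MetricSpace X] [MeasurableSpace X] [BorelSpace X]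
    (G : Subgroup (X ≃ᵢ X)) : Prop :=
  ∀ μ ν : FiniteMomentMeasure p X,
    ∃ g₀ : G, ∀ g : G, wassersteinDist (g₀ • μ) ν ≤ wassersteinDist (g • μ) ν

end ShapeSpace

open Filter Topology ProbabilityTheory TopologicalSpace

namespace ShapeSpace


/-! ### `L^p` distances of maps and the Wasserstein distance in `[0, ∞]` -/

section Basic

/-! Once the infimum over `G` is attained, everything descends from `P_p(X)`. Since `G` acts by
`W_p`-isometries, `D_p` is symmetric and satisfies the triangle inequality, and attainment turns
`D_p = 0` into equality of orbits. The quotient map is surjective and 1-Lipschitz, so separability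
passes down; a fast Cauchy sequence of classes lifts, through optimal translates, to a Cauchy
sequence of measures, so completeness passes down too (`completeSpace_shape`). It remains to see
that `(P_p(X), W_p)` is a complete separable metric space and that (a) implies (b).

For the former, no optimal plan is needed: `W_p` is the infimum over couplings of an `L^p` distance
of random points. Gluing couplings along conditional kernels gives the triangle inequality, and, for
infinitely many couplings at once, a random sequence whose almost sure limit has the limiting law
(`completeSpace_wasserstein`). Finitely supported measures on a dense sequence, with weights from a
countable set, are dense (`separableSpace_wasserstein`).

For the latter, a minimizing sequence in `G` displaces a fixed point by a bounded amount, so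
properness confines it to a compact set. A subsequence converges pointwise on `X`, hence its
push-forwards converge in `W_p` by dominated convergence (`minimizersExist_of_properSMul`). -/

theorem isProbabilityMeasure_of_mem_couplings {X : Type*} [MeasurableSpace X] {μ ν : Measure X}
    [IsProbabilityMeasure μ] {π : Measure (X × X)} (h : π ∈ couplings μ ν) :
    IsProbabilityMeasure π := by
  have : IsProbabilityMeasure (π.map Prod.fst) := h.1.symm ▸ inferInstance
  exact Measure.isProbabilityMeasure_of_map Prod.fst

theorem rpow_one_div_natCast_pow {p : ℕ} (hp : 1 ≤ p) (a : ℝ≥0∞) : (a ^ (1 / (p : ℝ))) ^ p = a := by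
  have : (p : ℝ) ≠ 0 := by positivity
  rw [← ENNReal.rpow_natCast, ← ENNReal.rpow_mul, one_div_mul_cancel this, ENNReal.rpow_one]

variable {Ω X : Type*} [MeasurableSpace Ω] [MetricSpace X]

/-- The `L^p` distance of two maps into a metric space. -/
noncomputable def lpEDist (p : ℕ) (P : Measure Ω) (f g : Ω → X) : ℝ≥0∞ :=
  (∫⁻ ω, edist (f ω) (g ω) ^ p ∂P) ^ (1 / (p : ℝ))

theorem lpEDist_comm (p : ℕ) (P : Measure Ω) (f g : Ω → X) :
    lpEDist p P f g = lpEDist p P g f := by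
  simp only [lpEDist, edist_comm]

theorem lpEDist_self {p : ℕ} (hp : 1 ≤ p) (P : Measure Ω) (f : Ω → X) : lpEDist p P f f = 0 := by
  have : 0 < p := hp
  simp [lpEDist, this.ne', this]

theorem lpEDist_pow {p : ℕ} (hp : 1 ≤ p) (P : Measure Ω) (f g : Ω → X) :
    lpEDist p P f g ^ p = ∫⁻ ω, edist (f ω) (g ω) ^ p ∂P := by
  exact rpow_one_div_natCast_pow hp _

theorem lpEDist_le_iff {p : ℕ} (hp : 1 ≤ p) (P : Measure Ω) (f g : Ω → X) (c : ℝ≥0∞) :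
    lpEDist p P f g ≤ c ↔ ∫⁻ ω, edist (f ω) (g ω) ^ p ∂P ≤ c ^ p := by
  rw [← lpEDist_pow hp, ENNReal.pow_le_pow_left_iff (by lia)]

theorem lpEDist_lt_top_iff {p : ℕ} (hp : 1 ≤ p) (P : Measure Ω) (f g : Ω → X) :
    lpEDist p P f g < ∞ ↔ ∫⁻ ω, edist (f ω) (g ω) ^ p ∂P < ∞ := by
  have : p ≠ 0 := by lia
  rw [← lpEDist_pow hp, ENNReal.pow_lt_top_iff]
  simp [this]

variable [MeasurableSpace X]

/-- The Wasserstein distance of two measures, with values in `[0, ∞]`. -/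
noncomputable def wassersteinEDist (p : ℕ) (μ ν : Measure X) : ℝ≥0∞ :=
  transportCost p μ ν ^ (1 / (p : ℝ))

/-- The power `1 / p` is an order isomorphism of `[0, ∞]`, so it commutes with the infimum. In this
form Minkowski's inequality applies coupling by coupling. -/
theorem wassersteinEDist_eq_iInf (p : ℕ) (hp : 1 ≤ p) (μ ν : Measure X) :
    wassersteinEDist p μ ν = ⨅ π : couplings μ ν, lpEDist p π.1 Prod.fst Prod.snd := by
  have hp' : (0 : ℝ) < 1 / (p : ℝ) := by positivity
  rw [wassersteinEDist, transportCost, iInf_subtype']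
  exact (ENNReal.orderIsoRpow _ hp').map_iInf _

variable [BorelSpace X] [SecondCountableTopology X]

theorem measurable_edist_pow (p : ℕ) : Measurable fun z : X × X => edist z.1 z.2 ^ p :=
  (measurable_fst.edist measurable_snd).pow_const p

theorem lpEDist_triangle {p : ℕ} (hp : 1 ≤ p) (P : Measure Ω) {f g h : Ω → X} (hf : Measurable f)
    (hg : Measurable g) (hh : Measurable h) :
    lpEDist p P f h ≤ lpEDist p P f g + lpEDist p P g h := by
  have := ENNReal.lintegral_Lp_add_le (μ := P) (p := p) (hf.edist hg).aemeasurable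
    (hg.edist hh).aemeasurable (by exact_mod_cast hp)
  simp only [Pi.add_apply, ENNReal.rpow_natCast] at this
  refine le_trans ?_ this
  unfold lpEDist
  gcongr
  exact edist_triangle _ _ _

theorem lpEDist_map {Ω' : Type*} [MeasurableSpace Ω'] (p : ℕ) (P : Measure Ω') {T : Ω' → Ω}
    (hT : Measurable T) {f g : Ω → X} (hf : Measurable f) (hg : Measurable g) :
    lpEDist p (P.map T) f g = lpEDist p P (f ∘ T) (g ∘ T) := by
  rw [lpEDist, lintegral_map ((hf.edist hg).pow_const p) hT]
  rfl

/-- The joint law of `f` and `g` is a coupling. Every upper bound on the Wasserstein distance below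
comes from this one. -/
theorem wassersteinEDist_map_le {p : ℕ} (hp : 1 ≤ p) (P : Measure Ω) {f g : Ω → X}
    (hf : Measurable f) (hg : Measurable g) :
    wassersteinEDist p (P.map f) (P.map g) ≤ lpEDist p P f g := by
  rw [wassersteinEDist_eq_iInf p hp]
  have hfg := hf.prodMk hg
  refine (iInf_le _ ⟨P.map fun ω => (f ω, g ω), ?_⟩).trans (le_of_eq ?_)
  · exact lpEDist_map p P hfg measurable_fst measurable_snd
  · exact ⟨by rw [Measure.map_map measurable_fst hfg]; rfl,
      by rw [Measure.map_map measurable_snd hfg]; rfl⟩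

theorem wassersteinEDist_self {p : ℕ} (hp : 1 ≤ p) (μ : Measure X) :
    wassersteinEDist p μ μ = 0 := by
  have := wassersteinEDist_map_le hp μ (f := id) (g := id) measurable_id measurable_id
  rwa [lpEDist_self hp, Measure.map_id, nonpos_iff_eq_zero] at this

theorem wassersteinEDist_comm {p : ℕ} (hp : 1 ≤ p) (μ ν : Measure X) :
    wassersteinEDist p μ ν = wassersteinEDist p ν μ := by
  suffices h : ∀ μ ν : Measure X, wassersteinEDist p μ ν ≤ wassersteinEDist p ν μ from
    le_antisymm (h _ _) (h _ _)
  intro μ ν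
  rw [wassersteinEDist_eq_iInf p hp ν μ]
  refine le_iInf fun ⟨π, hπ⟩ => ?_
  have := wassersteinEDist_map_le hp π (X := X) measurable_snd measurable_fst
  rw [hπ.1, hπ.2] at this
  rwa [lpEDist_comm]

/-- Measures at vanishing Wasserstein distance coincide. -/
theorem eq_of_wassersteinEDist_eq_zero {p : ℕ} (hp : 1 ≤ p) {μ ν : Measure X}
    [IsProbabilityMeasure μ] [IsProbabilityMeasure ν] (h : wassersteinEDist p μ ν = 0) :
    μ = ν := by
  have hLP : levyProkhorovEDist μ ν = 0 := by
    refine le_antisymm (levyProkhorovEDist_le_of_forall_le μ ν 0 fun ε B hε hε' hB => ?_) bot_le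
    -- The threshold `ε ^ p * ε` is chosen so that Markov's inequality gives some coupling mass at
    -- most `ε` on pairs at distance at least `ε`, which is the Lévy–Prokhorov condition.
    have hlt : wassersteinEDist p μ ν ^ p < ε ^ p * ε := by
      rw [h, zero_pow (by lia)]
      exact ENNReal.mul_pos (pow_ne_zero _ hε.ne') hε.ne'
    have hcost : transportCost p μ ν < ε ^ p * ε := by
      rwa [wassersteinEDist, rpow_one_div_natCast_pow hp] at hlt
    simp only [transportCost, iInf_lt_iff] at hcost
    obtain ⟨π, hπ, hlt⟩ := hcost
    have hmarkov : π {z | ε ^ p ≤ edist z.1 z.2 ^ p} ≤ ε := by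
      have h1 := mul_meas_ge_le_lintegral (μ := π) (measurable_edist_pow (X := X) p) (ε ^ p)
      exact (ENNReal.mul_le_mul_iff_right (pow_ne_zero _ hε.ne')
        (ENNReal.pow_ne_top hε'.ne)).1 (h1.trans hlt.le)
    rw [← hπ.1, ← hπ.2, Measure.map_apply measurable_fst hB,
      Measure.map_apply measurable_snd Metric.isOpen_thickening.measurableSet]
    refine (measure_mono (t := Prod.snd ⁻¹' Metric.thickening ε.toReal B ∪
      {z | ε ^ p ≤ edist z.1 z.2 ^ p}) fun z hz => ?_).trans
      ((measure_union_le _ _).trans (by gcongr))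
    by_cases hz' : ε ≤ edist z.1 z.2
    · exact Or.inr (pow_le_pow_left' hz' p)
    · refine Or.inl ((Metric.mem_thickening_iff_exists_edist_lt _ _).2 ⟨z.1, hz, ?_⟩)
      rw [ENNReal.ofReal_toReal hε'.ne, edist_comm]
      exact not_le.1 hz'
  -- Closed sets form a generating π-system, and vanishing Lévy–Prokhorov distance forces agreement
  -- on them.
  refine ext_of_generate_finite _ (BorelSpace.measurable_eq.trans borel_eq_generateFrom_isClosed)
    isPiSystem_isClosed (fun s hs => ?_) (by simp)
  exact measure_eq_measure_of_levyProkhorovEDist_eq_zero_of_isClosed hLP hs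
    ⟨1, one_pos, measure_ne_top _ _⟩ ⟨1, one_pos, measure_ne_top _ _⟩

end Basic

/-! ### Gluing of couplings -/

section Gluing

/-- A kernel that sees only `T` of the past yields a joint law determined by the law of `T`. This is
what makes glued measures have the prescribed pair marginals. -/
theorem map_compProd_comap {α β γ : Type*} [MeasurableSpace α] [MeasurableSpace β]
    [MeasurableSpace γ] (m : Measure α) [SFinite m] (κ : Kernel β γ) [IsSFiniteKernel κ]
    {T : α → β} (hT : Measurable T) :
    (m ⊗ₘ κ.comap T hT).map (Prod.map T id) = m.map T ⊗ₘ κ := by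
  ext s hs
  have hm : Measurable (Prod.map T (id : γ → γ)) := hT.prodMap measurable_id
  rw [Measure.map_apply hm hs, Measure.compProd_apply (hm hs), Measure.compProd_apply hs,
    lintegral_map (Kernel.measurable_kernel_prodMk_left hs) hT]
  rfl

/-- The trajectory kernel started at time 0 keeps the coordinate it starts from. -/
theorem map_eval_zero_trajMeasure {Y : ℕ → Type*} [∀ n, MeasurableSpace (Y n)]
    (m : Measure (Y 0)) [IsProbabilityMeasure m]
    (κ : (n : ℕ) → Kernel ((i : Finset.Iic n) → Y i) (Y (n + 1))) [∀ n, IsMarkovKernel (κ n)] :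
    (Kernel.trajMeasure m κ).map (fun x => x 0) = m := by
  let e : ((i : Finset.Iic 0) → Y i) → Y 0 := fun x => x ⟨0, Finset.mem_Iic.2 le_rfl⟩
  have he : Measurable e := measurable_pi_apply _
  have hid : (Kernel.traj κ 0).map (fun x => x 0) = Kernel.id.map e := by
    rw [← Kernel.partialTraj_self (κ := κ) 0, ← Kernel.traj_map_frestrictLe,
      ← Kernel.map_comp_right _ (by fun_prop) he]
    rfl
  rw [Kernel.trajMeasure, Measure.map_comp _ _ (by fun_prop), hid, ← Measure.map_comp _ _ he,
    Measure.id_comp]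
  exact (Measure.map_map he (MeasurableEquiv.measurable _)).trans Measure.map_id

variable {X : Type*} [MetricSpace X] [MeasurableSpace X] [BorelSpace X]
  [SecondCountableTopology X] [CompleteSpace X]

/-- Couplings of consecutive measures are realized by one random sequence. -/
theorem exists_measure_forall_map_eq (μ : ℕ → Measure X) [∀ n, IsProbabilityMeasure (μ n)]
    (π : ℕ → Measure (X × X)) (hπ : ∀ n, π n ∈ couplings (μ n) (μ (n + 1))) :
    ∃ P : Measure (ℕ → X), IsProbabilityMeasure P ∧
      (∀ n, P.map (fun x => x n) = μ n) ∧
      ∀ n, P.map (fun x => (x n, x (n + 1))) = π n := by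
  have : Nonempty X := nonempty_of_isProbabilityMeasure (μ 0)
  have hprob n : IsProbabilityMeasure (π n) := isProbabilityMeasure_of_mem_couplings (hπ n)
  let e (n : ℕ) : (Finset.Iic n → X) → X := fun x => x ⟨n, Finset.mem_Iic.2 le_rfl⟩
  have he n : Measurable (e n) := measurable_pi_apply _
  -- Markov chain: the next point is drawn from the conditional law under `π n` given the last point
  -- alone.
  let κ (n : ℕ) : Kernel (Finset.Iic n → X) X := (π n).condKernel.comap (e n) (he n)
  have hκ n : IsMarkovKernel (κ n) := inferInstance
  let P := Kernel.trajMeasure (X := fun _ => X) (μ 0) κ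
  have hfst0 : P.map (fun x => x 0) = μ 0 := by
    exact map_eval_zero_trajMeasure (Y := fun _ => X) (μ 0) κ
  have step n (h : P.map (fun x => x n) = μ n) : P.map (fun x => (x n, x (n + 1))) = π n := by
    have h1 := Kernel.map_frestrictLe_trajMeasure_compProd_eq_map_trajMeasure
      (X := fun _ => X) (μ₀ := μ 0) (κ := κ) (a := n)
    have h2 := congrArg (Measure.map (Prod.map (e n) id)) h1
    rw [map_compProd_comap, Measure.map_map (by fun_prop) (by fun_prop),
      Measure.map_map (by fun_prop) (by fun_prop)] at h2
    refine h2.symm.trans ?_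
    have h3 : P.map (e n ∘ Preorder.frestrictLe n) = (π n).fst := h.trans (hπ n).1.symm
    exact (congrArg (· ⊗ₘ (π n).condKernel) h3).trans ((π n).disintegrate _)
  have hfst n : P.map (fun x => x n) = μ n := by
    induction n with
    | zero => exact hfst0
    | succ n ih =>
      rw [← (hπ n).2, ← step n ih, Measure.map_map measurable_snd (by fun_prop)]
      rfl
  exact ⟨P, inferInstance, hfst, fun n => step n (hfst n)⟩

/-- Two couplings sharing the marginal `ν` are glued into a law of triples, on which Minkowski's
inequality holds. As the couplings are arbitrary, infima suffice. -/
theorem wassersteinEDist_triangle {p : ℕ} (hp : 1 ≤ p) (μ ν ρ : Measure X)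
    [IsProbabilityMeasure μ] [IsProbabilityMeasure ν] [IsProbabilityMeasure ρ] :
    wassersteinEDist p μ ρ ≤ wassersteinEDist p μ ν + wassersteinEDist p ν ρ := by
  have : Nonempty X := nonempty_of_isProbabilityMeasure μ
  rw [wassersteinEDist_eq_iInf p hp μ ν, wassersteinEDist_eq_iInf p hp ν ρ, ENNReal.iInf_add]
  refine le_iInf fun ⟨π, hπ⟩ => ?_
  rw [ENNReal.add_iInf]
  refine le_iInf fun ⟨π', hπ'⟩ => ?_
  have := isProbabilityMeasure_of_mem_couplings hπ
  have := isProbabilityMeasure_of_mem_couplings hπ'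
  let P : Measure ((X × X) × X) := π ⊗ₘ π'.condKernel.comap Prod.snd measurable_snd
  have h1 : P.map Prod.fst = π := Measure.fst_compProd _ _
  have h2 : P.map (Prod.map Prod.snd id) = π' := by
    refine (map_compProd_comap _ _ _).trans ?_
    rw [hπ.2, ← hπ'.1]
    exact π'.disintegrate _
  have ha : Measurable fun z : (X × X) × X => z.1.1 := by fun_prop
  have hb : Measurable fun z : (X × X) × X => z.1.2 := by fun_prop
  have hc : Measurable fun z : (X × X) × X => z.2 := by fun_prop
  have hμ : P.map (fun z => z.1.1) = μ := by
    rw [← hπ.1, ← h1, Measure.map_map measurable_fst measurable_fst]; rfl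
  have hρ : P.map (fun z => z.2) = ρ := by
    rw [← hπ'.2, ← h2, Measure.map_map measurable_snd (by fun_prop)]; rfl
  calc wassersteinEDist p μ ρ
      ≤ lpEDist p P (fun z => z.1.1) (fun z => z.2) := by
        rw [← hμ, ← hρ]; exact wassersteinEDist_map_le hp P ha hc
    _ ≤ _ := lpEDist_triangle hp P ha hb hc
    _ = lpEDist p π Prod.fst Prod.snd + lpEDist p π' Prod.fst Prod.snd := by
        congr 1
        · conv_rhs => rw [← h1, lpEDist_map p P measurable_fst measurable_fst measurable_snd]
          rfl
        · conv_rhs => rw [← h2, lpEDist_map p P (by fun_prop) measurable_fst measurable_snd]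
          rfl

end Gluing


/-! ### Limits of fast Cauchy sequences -/

section Completeness

theorem lintegral_edist_le_lpEDist {Ω X : Type*} [MeasurableSpace Ω] [MetricSpace X]
    [MeasurableSpace X] [BorelSpace X] [SecondCountableTopology X] {p : ℕ} (hp : 1 ≤ p)
    (P : Measure Ω) [IsProbabilityMeasure P] {f g : Ω → X} (hf : Measurable f)
    (hg : Measurable g) :
    ∫⁻ ω, edist (f ω) (g ω) ∂P ≤ lpEDist p P f g := by
  have := eLpNorm'_le_eLpNorm'_of_exponent_le (p := 1) (q := p) one_pos (by exact_mod_cast hp) P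
    (hf.edist hg).aestronglyMeasurable
  simpa [eLpNorm', lpEDist] using this

variable {X : Type*} [MetricSpace X] [MeasurableSpace X] [BorelSpace X]
  [SecondCountableTopology X] [CompleteSpace X]

/-- A sequence of random points with geometrically decreasing consecutive `L^p` distances
converges in `L^p`. -/
theorem exists_lpEDist_limit {Ω : Type*} [MeasurableSpace Ω] {p : ℕ} (hp : 1 ≤ p)
    (P : Measure Ω) [IsProbabilityMeasure P] {f : ℕ → Ω → X} (hf : ∀ n, Measurable (f n))
    (h : ∀ n, lpEDist p P (f n) (f (n + 1)) ≤ 2⁻¹ ^ n) :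
    ∃ g : Ω → X, Measurable g ∧ ∀ n, lpEDist p P (f n) g ≤ 2 * 2⁻¹ ^ n := by
  have hgap n m : lpEDist p P (f n) (f (n + m)) ≤ 2 * 2⁻¹ ^ n := by
    -- Peeling off the first step closes the induction, because `2⁻¹ ^ n + 2 * 2⁻¹ ^ (n + 1) = 2 *
    -- 2⁻¹ ^ n`.
    induction m generalizing n with
    | zero => simp [lpEDist_self hp]
    | succ m ih =>
      have h2 := ih (n + 1)
      rw [add_right_comm] at h2
      refine (lpEDist_triangle hp P (hf n) (hf (n + 1)) (hf _)).trans
        ((add_le_add (h n) h2).trans (le_of_eq ?_))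
      rw [pow_succ', ← mul_assoc, ENNReal.mul_inv_cancel two_ne_zero ENNReal.ofNat_ne_top,
        one_mul, two_mul]
  -- The expected total length of the path is finite, so almost every path is Cauchy.
  have hsum : ∫⁻ ω, ∑' n, edist (f n ω) (f (n + 1) ω) ∂P ≠ ∞ := by
    rw [lintegral_tsum fun n => ((hf n).edist (hf (n + 1))).aemeasurable]
    refine ((ENNReal.tsum_le_tsum fun n =>
      (lintegral_edist_le_lpEDist hp P (hf n) (hf (n + 1))).trans (h n)).trans_lt ?_).ne
    rw [ENNReal.tsum_geometric]
    simp
  have hlim : ∀ᵐ ω ∂P, ∃ l, Tendsto (fun n => f n ω) atTop (𝓝 l) := by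
    filter_upwards [ae_lt_top (.tsum fun n => (hf n).edist (hf (n + 1))) hsum] with ω hω
    exact cauchySeq_tendsto_of_complete
      (cauchySeq_of_edist_le_of_tsum_ne_top _ (fun n => le_rfl) hω.ne)
  obtain ⟨g, hg, hfg⟩ := measurable_limit_of_tendsto_metrizable_ae
    (fun n => (hf n).aemeasurable) hlim
  refine ⟨g, hg, fun n => (lpEDist_le_iff hp _ _ _ _).2 ?_⟩
  -- Fatou's lemma carries the uniform bound `hgap` to the limit.
  calc ∫⁻ ω, edist (f n ω) (g ω) ^ p ∂P
      = ∫⁻ ω, liminf (fun m => edist (f n ω) (f (n + m) ω) ^ p) atTop ∂P := by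
        refine lintegral_congr_ae ?_
        filter_upwards [hfg] with ω hω
        have h1 : Tendsto (fun m => f (n + m) ω) atTop (𝓝 (g ω)) :=
          hω.comp (tendsto_atTop_mono (fun m => Nat.le_add_left m n) tendsto_id)
        have h2 := ((ENNReal.continuous_pow p).tendsto _).comp
          ((tendsto_const_nhds (x := f n ω)).edist h1)
        exact h2.liminf_eq.symm
    _ ≤ liminf (fun m => ∫⁻ ω, edist (f n ω) (f (n + m) ω) ^ p ∂P) atTop :=
        lintegral_liminf_le fun m => ((hf n).edist (hf (n + m))).pow_const p
    _ ≤ liminf (fun _ : ℕ => (2 * 2⁻¹ ^ n) ^ p) atTop :=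
        liminf_le_liminf (Eventually.of_forall fun m => (lpEDist_le_iff hp _ _ _ _).1 (hgap n m))
    _ = _ := liminf_const _

theorem exists_wassersteinEDist_limit {p : ℕ} (hp : 1 ≤ p) (μ : ℕ → Measure X)
    [∀ n, IsProbabilityMeasure (μ n)]
    (h : ∀ n, wassersteinEDist p (μ n) (μ (n + 1)) < 2⁻¹ ^ n) :
    ∃ ν : Measure X, IsProbabilityMeasure ν ∧
      ∀ n, wassersteinEDist p (μ n) ν ≤ 2 * 2⁻¹ ^ n := by
  simp only [wassersteinEDist_eq_iInf p hp, iInf_lt_iff] at h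
  choose π hπ using h
  obtain ⟨P, hP, hμ, hcons⟩ := exists_measure_forall_map_eq μ (fun n => (π n).1) fun n => (π n).2
  have hL n : lpEDist p P (fun x => x n) (fun x => x (n + 1)) ≤ 2⁻¹ ^ n := by
    refine le_trans (le_of_eq ?_) (hπ n).le
    rw [← hcons, lpEDist_map p P (by fun_prop) measurable_fst measurable_snd]
    rfl
  obtain ⟨g, hg, hlim⟩ := exists_lpEDist_limit hp P (fun n => measurable_pi_apply n) hL
  refine ⟨P.map g, Measure.isProbabilityMeasure_map hg.aemeasurable, fun n => ?_⟩
  rw [← hμ n]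
  exact (wassersteinEDist_map_le hp P (measurable_pi_apply n) hg).trans (hlim n)

end Completeness

/-! ### The complete metric on `P_p(X)` -/

section Metric

variable {X : Type*} [MetricSpace X] [MeasurableSpace X] [BorelSpace X]
  [SecondCountableTopology X] {p : ℕ}

theorem lpEDist_const (hp : 1 ≤ p) (μ : Measure X) [IsProbabilityMeasure μ] (x y : X) :
    lpEDist p μ (fun _ => x) (fun _ => y) = edist x y := by
  refine le_antisymm ((lpEDist_le_iff hp _ _ _ _).2 (by simp)) ?_
  have := lintegral_edist_le_lpEDist hp μ (measurable_const (a := x)) (measurable_const (a := y))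
  simpa using this

theorem wassersteinEDist_dirac_le (hp : 1 ≤ p) (μ : Measure X) [IsProbabilityMeasure μ] (x : X) :
    wassersteinEDist p (Measure.dirac x) μ ≤ lpEDist p μ (fun _ => x) id := by
  simpa using wassersteinEDist_map_le hp μ (measurable_const (a := x)) measurable_id

theorem edist_le_wassersteinEDist_dirac (hp : 1 ≤ p) (x y : X) :
    edist x y ≤ wassersteinEDist p (Measure.dirac x) (Measure.dirac y) := by
  rw [wassersteinEDist_eq_iInf p hp]
  refine le_iInf fun ⟨π, hπ⟩ => ?_
  have := isProbabilityMeasure_of_mem_couplings hπ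
  have h1 : ∀ᵐ z ∂π, z.1 = x := by
    have : ∀ᵐ z ∂π.map Prod.fst, z = x := by
      rw [hπ.1, ae_dirac_eq]; rfl
    exact ae_of_ae_map measurable_fst.aemeasurable this
  have h2 : ∀ᵐ z ∂π, z.2 = y := by
    have : ∀ᵐ z ∂π.map Prod.snd, z = y := by
      rw [hπ.2, ae_dirac_eq]; rfl
    exact ae_of_ae_map measurable_snd.aemeasurable this
  refine le_trans ?_ (lintegral_edist_le_lpEDist hp π measurable_fst measurable_snd)
  rw [lintegral_congr_ae (g := fun _ => edist x y)
    (by filter_upwards [h1, h2] with z hx hy; rw [hx, hy])]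
  simp

instance (μ : FiniteMomentMeasure p X) : IsProbabilityMeasure μ.toMeasure :=
  μ.isProbabilityMeasure

theorem lpEDist_const_lt_top (hp : 1 ≤ p) (μ : FiniteMomentMeasure p X) (x : X) :
    lpEDist p μ.toMeasure (fun _ => x) id < ∞ := by
  obtain ⟨y, hy⟩ := μ.hasFiniteMoment
  refine (lpEDist_triangle hp _ measurable_const (measurable_const (a := y))
    measurable_id).trans_lt ?_
  rw [lpEDist_const hp, ENNReal.add_lt_top]
  exact ⟨edist_lt_top _ _, (lpEDist_lt_top_iff hp _ _ _).2 hy⟩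

/-- Under a coupling of finite cost, the `L^p` triangle inequality transfers the moment from one
marginal to the other. This keeps limits and discrete approximants inside `P_p(X)`. -/
theorem hasFiniteMoment_of_wassersteinEDist_lt_top (hp : 1 ≤ p) (μ : FiniteMomentMeasure p X)
    (ν : Measure X) [IsProbabilityMeasure ν] (h : wassersteinEDist p μ.toMeasure ν < ∞) :
    HasFiniteMoment p ν := by
  obtain ⟨x, -⟩ := μ.hasFiniteMoment
  refine ⟨x, ?_⟩
  rw [wassersteinEDist_eq_iInf p hp, iInf_lt_iff] at h
  obtain ⟨⟨π, hπ⟩, hlt⟩ := h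
  have h1 : lpEDist p π (fun _ => x) Prod.fst < ∞ := by
    refine lt_of_eq_of_lt ?_ (lpEDist_const_lt_top hp μ x)
    rw [← hπ.1, lpEDist_map p π measurable_fst measurable_const measurable_id]
    rfl
  refine (lpEDist_lt_top_iff hp ν (fun _ => x) id).1 ?_
  rw [← hπ.2,
    lpEDist_map p π measurable_snd measurable_const measurable_id]
  exact (lpEDist_triangle hp π measurable_const measurable_fst measurable_snd).trans_lt
    (ENNReal.add_lt_top.2 ⟨h1, hlt⟩)

variable [CompleteSpace X]

theorem wassersteinEDist_lt_top (hp : 1 ≤ p) (μ ν : FiniteMomentMeasure p X) :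
    wassersteinEDist p μ.toMeasure ν.toMeasure < ∞ := by
  obtain ⟨x, -⟩ := μ.hasFiniteMoment
  refine (wassersteinEDist_triangle hp _ (Measure.dirac x) _).trans_lt
    (ENNReal.add_lt_top.2 ⟨?_, ?_⟩)
  · rw [wassersteinEDist_comm hp]
    exact (wassersteinEDist_dirac_le hp _ x).trans_lt (lpEDist_const_lt_top hp μ x)
  · exact (wassersteinEDist_dirac_le hp _ x).trans_lt (lpEDist_const_lt_top hp ν x)

theorem ofReal_wassersteinDist (hp : 1 ≤ p) (μ ν : FiniteMomentMeasure p X) :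
    ENNReal.ofReal (wassersteinDist μ ν) = wassersteinEDist p μ.toMeasure ν.toMeasure :=
  ENNReal.ofReal_toReal (wassersteinEDist_lt_top hp μ ν).ne

theorem eq_of_wassersteinDist_eq_zero (hp : 1 ≤ p) {μ ν : FiniteMomentMeasure p X}
    (h : wassersteinDist μ ν = 0) : μ = ν := by
  refine FiniteMomentMeasure.ext (eq_of_wassersteinEDist_eq_zero hp ?_)
  rw [← ofReal_wassersteinDist hp, h, ENNReal.ofReal_zero]

/-- The Wasserstein metric on `P_p(X)`. -/
@[reducible]
noncomputable def wassersteinPseudoMetricSpace (hp : 1 ≤ p) :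
    PseudoMetricSpace (FiniteMomentMeasure p X) where
  dist := wassersteinDist
  dist_self μ := by
    change (wassersteinEDist p μ.toMeasure μ.toMeasure).toReal = 0
    rw [wassersteinEDist_self hp, ENNReal.toReal_zero]
  dist_comm μ ν := congrArg ENNReal.toReal (wassersteinEDist_comm hp μ.toMeasure ν.toMeasure)
  dist_triangle μ ν ρ := by
    have h1 := (wassersteinEDist_lt_top hp μ ν).ne
    have h2 := (wassersteinEDist_lt_top hp ν ρ).ne
    exact (ENNReal.toReal_mono (ENNReal.add_ne_top.2 ⟨h1, h2⟩)
      (wassersteinEDist_triangle hp _ ν.toMeasure _)).trans (ENNReal.toReal_add h1 h2).le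

theorem completeSpace_wasserstein (hp : 1 ≤ p) :
    @CompleteSpace (FiniteMomentMeasure p X)
      (wassersteinPseudoMetricSpace hp).toUniformSpace := by
  let _ : PseudoMetricSpace (FiniteMomentMeasure p X) := wassersteinPseudoMetricSpace hp
  refine Metric.complete_of_convergent_controlled_sequences (fun n => 2⁻¹ ^ n)
    (fun n => by positivity) fun u hu => ?_
  have hofReal (n : ℕ) : ENNReal.ofReal (2⁻¹ ^ n) = 2⁻¹ ^ n := by
    rw [ENNReal.ofReal_pow (by norm_num), ENNReal.ofReal_inv_of_pos two_pos, ENNReal.ofReal_ofNat]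
  obtain ⟨ν, hν, hlim⟩ := exists_wassersteinEDist_limit hp (fun n => (u n).toMeasure) fun n => by
    rw [← ofReal_wassersteinDist hp, ← hofReal]
    exact (ENNReal.ofReal_lt_ofReal_iff (by positivity)).2 (hu n n (n + 1) le_rfl n.le_succ)
  have hfin := hasFiniteMoment_of_wassersteinEDist_lt_top hp (u 0) ν
    ((hlim 0).trans_lt (by simp))
  refine ⟨⟨ν, hν, hfin⟩, tendsto_iff_dist_tendsto_zero.2 ?_⟩
  refine squeeze_zero (fun _ => dist_nonneg) (g := fun n => 2 * 2⁻¹ ^ n) (fun n => ?_) ?_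
  · refine (ENNReal.toReal_mono (by finiteness) (hlim n)).trans (le_of_eq ?_)
    simp
  · simpa using (tendsto_pow_atTop_nhds_zero_of_lt_one (r := (2⁻¹ : ℝ)) (by norm_num)
      (by norm_num)).const_mul 2

end Metric


/-! ### Separability of `P_p(X)` -/

section Separability

variable {X : Type*} [MetricSpace X] [MeasurableSpace X] [BorelSpace X]
  [SecondCountableTopology X] {p : ℕ}

/-- The measure with weights `q i` at the points `e i` and the remaining mass at `x`. -/
noncomputable def discreteMeasure {ι : Type*} [Fintype ι] [MeasurableSpace ι] (e : ι → X) (x : X)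
    (q : ι → ℝ≥0∞) : Measure X :=
  (∑ i, q i • Measure.dirac i).map e + (1 - ∑ i, q i) • Measure.dirac x

theorem exists_mem_le_sub_le {C : Set ℝ≥0∞} (hC : Dense C) (h0 : 0 ∈ C) {w η : ℝ≥0∞}
    (hw : w ≠ ∞) (hη : η ≠ 0) : ∃ q ∈ C, q ≤ w ∧ w - q ≤ η := by
  rcases eq_or_ne w 0 with rfl | hw0
  · exact ⟨0, h0, le_rfl, by simp⟩
  · obtain ⟨q, hq, h1, h2⟩ := hC.exists_between (ENNReal.sub_lt_self hw hw0 hη)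
    exact ⟨q, hq, h2.le, tsub_le_iff_left.2 (tsub_le_iff_right.1 h1.le)⟩

/-- The weights of a finitely supported probability measure can be taken in a dense set, up to
moving a small mass to a fixed point. -/
theorem exists_discreteMeasure_approx (hp : 1 ≤ p) {ι : Type*} [Fintype ι] [MeasurableSpace ι]
    [MeasurableSingletonClass ι] (ρ : Measure ι) [IsProbabilityMeasure ρ] (e : ι → X) (x : X)
    {C : Set ℝ≥0∞} (hC : Dense C) (h0 : 0 ∈ C) {ε : ℝ≥0∞} (hε : ε ≠ 0) :
    ∃ q : ι → C, IsProbabilityMeasure (discreteMeasure e x fun i => q i) ∧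
      wassersteinEDist p (ρ.map e) (discreteMeasure e x fun i => q i) ≤ ε := by
  have hM : ∑ i, edist (e i) x ^ p ≠ ∞ :=
    ENNReal.sum_ne_top.2 fun i _ => ENNReal.pow_ne_top (edist_ne_top _ _)
  -- Each atom `e i` will send mass at most `η` to `x`, at total cost at most `η * ∑ i, edist (e i)
  -- x ^ p`.
  obtain ⟨η, hη, hηM⟩ := ENNReal.exists_nnreal_pos_mul_lt hM (pow_ne_zero p hε)
  choose q hqC hq hη' using fun i => exists_mem_le_sub_le (η := η) hC h0
    (measure_ne_top ρ {i}) (ENNReal.coe_ne_zero.2 hη.ne')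
  have he : Measurable e := measurable_of_finite e
  let r : Measure ι := ∑ i, q i • Measure.dirac i
  let s : Measure ι := ∑ i, (ρ {i} - q i) • Measure.dirac i
  have hrs : r + s = ρ := by
    conv_rhs => rw [← Measure.sum_smul_dirac ρ, Measure.sum_fintype]
    simp only [r, s]
    rw [← Finset.sum_add_distrib]
    refine Finset.sum_congr rfl fun i _ => ?_
    rw [← add_smul, add_tsub_cancel_of_le (hq i)]
  have hr : r Set.univ = ∑ i, q i := by simp [r]
  have hs : s Set.univ = 1 - ∑ i, q i := by
    have h1 : s Set.univ + r Set.univ = 1 := by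
      rw [add_comm, ← Measure.add_apply, hrs, measure_univ]
    rw [← hr]
    refine ENNReal.eq_sub_of_add_eq ?_ h1
    exact ((le_add_left le_rfl).trans h1.le |>.trans_lt ENNReal.one_lt_top).ne
  have hd : Measurable fun i => (e i, e i) := measurable_of_finite _
  have hx : Measurable fun i => (e i, x) := measurable_of_finite _
  -- The plan leaves the rounded-down mass `r` in place and moves the excess `s` to `x`.
  let P : Measure (X × X) := r.map (fun i => (e i, e i)) + s.map (fun i => (e i, x))
  have hfst : P.map Prod.fst = ρ.map e := by
    rw [Measure.map_add _ _ measurable_fst, Measure.map_map measurable_fst hd,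
      Measure.map_map measurable_fst hx, ← hrs, Measure.map_add _ _ he]
    rfl
  have hsnd : P.map Prod.snd = discreteMeasure e x q := by
    rw [Measure.map_add _ _ measurable_snd, Measure.map_map measurable_snd hd,
      Measure.map_map measurable_snd hx, discreteMeasure, ← hs, ← Measure.map_const]
    rfl
  have hP : IsProbabilityMeasure P := by
    have : IsProbabilityMeasure (P.map Prod.fst) :=
      hfst ▸ Measure.isProbabilityMeasure_map he.aemeasurable
    exact Measure.isProbabilityMeasure_of_map Prod.fst
  refine ⟨fun i => ⟨q i, hqC i⟩, ?_, ?_⟩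
  · exact hsnd ▸ Measure.isProbabilityMeasure_map measurable_snd.aemeasurable
  · refine (le_of_eq (by rw [hfst, hsnd])).trans
      ((wassersteinEDist_map_le hp P measurable_fst measurable_snd).trans
        ((lpEDist_le_iff hp _ _ _ _).2 ?_))
    rw [lintegral_add_measure, lintegral_map (measurable_edist_pow p) hd,
      lintegral_map (measurable_edist_pow p) hx]
    have hp0 : p ≠ 0 := by lia
    simp only [edist_self, zero_pow hp0, lintegral_zero, zero_add, s]
    rw [lintegral_finsetSum_measure]
    refine le_trans ?_ hηM.le
    rw [Finset.mul_sum]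
    refine Finset.sum_le_sum fun i _ => ?_
    rw [lintegral_smul_measure, lintegral_dirac' _ (measurable_of_finite _), smul_eq_mul]
    gcongr
    exact hη' i

/-- Measures with finite moment are approximated by images under nearest point maps. -/
theorem tendsto_lpEDist_nearestPt (hp : 1 ≤ p) (μ : FiniteMomentMeasure p X) {e : ℕ → X}
    (he : DenseRange e) :
    Tendsto (fun N => ∫⁻ x, edist (SimpleFunc.nearestPt e N x) x ^ p ∂μ.toMeasure) atTop
      (𝓝 0) := by
  have hp0 : p ≠ 0 := by lia
  have := tendsto_lintegral_of_dominated_convergence (μ := μ.toMeasure)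
    (F := fun N x => edist (SimpleFunc.nearestPt e N x) x ^ p) (f := fun _ => 0)
    (fun x => edist (e 0) x ^ p)
    (fun N => ((SimpleFunc.measurable _).edist measurable_id).pow_const p)
    (fun N => Eventually.of_forall fun x =>
      pow_le_pow_left' (SimpleFunc.edist_nearestPt_le e x zero_le) p)
    ((lpEDist_lt_top_iff hp _ _ _).1 (lpEDist_const_lt_top hp μ (e 0))).ne
    (Eventually.of_forall fun x => by
      have h1 := (SimpleFunc.tendsto_nearestPt (he x)).edist (tendsto_const_nhds (x := x))
      have h2 := ((ENNReal.continuous_pow p).tendsto _).comp h1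
      rwa [edist_self, zero_pow hp0] at h2)
  simpa using this

variable [CompleteSpace X]

theorem separableSpace_wasserstein (hp : 1 ≤ p) :
    @SeparableSpace (FiniteMomentMeasure p X)
      (wassersteinPseudoMetricSpace hp).toUniformSpace.toTopologicalSpace := by
  let _ : PseudoMetricSpace (FiniteMomentMeasure p X) := wassersteinPseudoMetricSpace hp
  rcases isEmpty_or_nonempty X with hX | hX
  -- A finite moment requires a base point, so `P_p(∅)` is empty.
  · exact ⟨∅, Set.countable_empty, fun μ => isEmptyElim μ.hasFiniteMoment.choose⟩
  obtain ⟨C₀, hC₀, hdense₀⟩ := exists_countable_dense ℝ≥0∞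
  -- Null atoms can only be rounded down to 0, so 0 must be an allowed weight.
  let C := insert 0 C₀
  have hC : Dense C := hdense₀.mono (Set.subset_insert _ _)
  have : Countable C := (hC₀.insert 0).to_subtype
  let e := denseSeq X
  let D (k : Σ N : ℕ, Fin (N + 1) → C) : Measure X :=
    discreteMeasure (fun i : Fin (k.1 + 1) => e i) (e 0) fun i => k.2 i
  refine ⟨FiniteMomentMeasure.toMeasure ⁻¹' Set.range D,
    (Set.countable_range D).preimage_of_injOn fun _ _ _ _ h => FiniteMomentMeasure.ext h, ?_⟩
  refine Metric.dense_iff.2 fun μ r hr => ?_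
  obtain ⟨ε, hε, hεr⟩ : ∃ ε : ℝ≥0∞, 0 < ε ∧ ε + ε < ENNReal.ofReal r := by
    refine ⟨ENNReal.ofReal (r / 3), by simpa using hr, ?_⟩
    rw [← ENNReal.ofReal_add (by positivity) (by positivity)]
    exact (ENNReal.ofReal_lt_ofReal_iff hr).2 (by linarith)
  obtain ⟨N, hN⟩ := ((tendsto_lpEDist_nearestPt hp μ (denseRange_denseSeq X)).eventually
    (gt_mem_nhds (pos_iff_ne_zero.2 (pow_ne_zero p hε.ne')))).exists
  -- Nearest-point indices are at most `N`, so the nearest-point map factors through a finite type.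
  let T : X → Fin (N + 1) := fun x => Fin.ofNat (N + 1) (SimpleFunc.nearestPtInd e N x)
  have hT : Measurable T :=
    (Measurable.of_discrete (f := Fin.ofNat (N + 1))).comp (SimpleFunc.measurable _)
  have heT : (fun i : Fin (N + 1) => e i) ∘ T = SimpleFunc.nearestPt e N := by
    funext x
    simp [T, SimpleFunc.nearestPt, Nat.mod_eq_of_lt
      (Nat.lt_succ_of_le (SimpleFunc.nearestPtInd_le e N x))]
  have hρ : IsProbabilityMeasure (μ.toMeasure.map T) :=
    Measure.isProbabilityMeasure_map hT.aemeasurable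
  obtain ⟨q, hq, hqε⟩ := exists_discreteMeasure_approx hp (μ.toMeasure.map T)
    (fun i : Fin (N + 1) => e i) (e 0) hC (Set.mem_insert _ _) hε.ne'
  rw [Measure.map_map (measurable_of_finite _) hT, heT] at hqε
  have hn : IsProbabilityMeasure (μ.toMeasure.map (SimpleFunc.nearestPt e N)) :=
    Measure.isProbabilityMeasure_map (SimpleFunc.measurable _).aemeasurable
  have h1 : wassersteinEDist p (μ.toMeasure.map (SimpleFunc.nearestPt e N)) μ.toMeasure ≤ ε := by
    have := wassersteinEDist_map_le hp μ.toMeasure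
      (SimpleFunc.measurable (SimpleFunc.nearestPt e N)) measurable_id
    rw [Measure.map_id] at this
    exact this.trans ((lpEDist_le_iff hp _ _ _ _).2 hN.le)
  rw [wassersteinEDist_comm hp] at h1
  have hlt : wassersteinEDist p μ.toMeasure (D ⟨N, q⟩) < ENNReal.ofReal r :=
    ((wassersteinEDist_triangle hp _ _ _).trans (add_le_add h1 hqε)).trans_lt hεr
  refine ⟨⟨D ⟨N, q⟩, hq, hasFiniteMoment_of_wassersteinEDist_lt_top hp μ _
    (hlt.trans ENNReal.ofReal_lt_top)⟩, ?_, ⟨⟨N, q⟩, rfl⟩⟩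
  rw [Metric.mem_ball']
  exact ENNReal.toReal_lt_of_lt_ofReal hlt

end Separability


/-! ### Descent to shape space -/

section Shape

variable {X : Type*} [MetricSpace X] [MeasurableSpace X] [BorelSpace X] {p : ℕ}
  {G : Subgroup (X ≃ᵢ X)}

theorem shapeDist_mk_le (μ ν : FiniteMomentMeasure p X) (g : G) :
    shapeDist (Shape.mk G μ) (Shape.mk G ν) ≤ wassersteinDist (g • μ) ν :=
  ciInf_le ⟨0, by rintro _ ⟨g, rfl⟩; exact ENNReal.toReal_nonneg⟩ g

theorem MinimizersExist.exists_shapeDist_mk_eq (h : MinimizersExist p G)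
    (μ ν : FiniteMomentMeasure p X) :
    ∃ g : G, shapeDist (Shape.mk G μ) (Shape.mk G ν) = wassersteinDist (g • μ) ν := by
  obtain ⟨g, hg⟩ := h μ ν
  exact ⟨g, le_antisymm (shapeDist_mk_le μ ν g) (le_ciInf hg)⟩

theorem Shape.mk_surjective : Function.Surjective (Shape.mk (p := p) G) :=
  Quotient.mk_surjective

theorem Shape.mk_smul (g : G) (μ : FiniteMomentMeasure p X) : Shape.mk G (g • μ) = Shape.mk G μ :=
  (Shape.mk_eq_mk_iff G _ _).2 ⟨g, rfl⟩

variable [CompleteSpace X] [SecondCountableTopology X]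

/-- The shape distance is a metric as soon as it is attained. -/
@[reducible]
noncomputable def shapeMetricSpace (hp : 1 ≤ p) (h : MinimizersExist p G) :
    MetricSpace (Shape p G) :=
  let _ : PseudoMetricSpace (FiniteMomentMeasure p X) := wassersteinPseudoMetricSpace hp
  { dist := shapeDist
    dist_self := by
      intro s
      obtain ⟨μ, rfl⟩ := Shape.mk_surjective s
      refine le_antisymm ((shapeDist_mk_le μ μ 1).trans (le_of_eq ?_))
        (Real.iInf_nonneg fun _ => ENNReal.toReal_nonneg)
      rw [one_smul]
      exact dist_self μ
    dist_comm := by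
      suffices hle : ∀ s t : Shape p G, shapeDist s t ≤ shapeDist t s from
        fun s t => le_antisymm (hle s t) (hle t s)
      intro s t
      obtain ⟨μ, rfl⟩ := Shape.mk_surjective s
      obtain ⟨ν, rfl⟩ := Shape.mk_surjective t
      obtain ⟨g, hg⟩ := h.exists_shapeDist_mk_eq ν μ
      rw [hg]
      refine (shapeDist_mk_le μ ν g⁻¹).trans (le_of_eq ?_)
      rw [← wassersteinDist_smul_smul (g : X ≃ᵢ X)]
      change wassersteinDist (g • g⁻¹ • μ) (g • ν) = _
      rw [smul_inv_smul]
      exact dist_comm μ (g • ν)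
    dist_triangle := by
      intro s t u
      obtain ⟨μ, rfl⟩ := Shape.mk_surjective s
      obtain ⟨ν, rfl⟩ := Shape.mk_surjective t
      obtain ⟨ρ, rfl⟩ := Shape.mk_surjective u
      obtain ⟨g, hg⟩ := h.exists_shapeDist_mk_eq μ ν
      obtain ⟨k, hk⟩ := h.exists_shapeDist_mk_eq ν ρ
      rw [hg, hk, ← wassersteinDist_smul_smul (k : X ≃ᵢ X) (g • μ) ν]
      refine (shapeDist_mk_le μ ρ (k * g)).trans ?_
      rw [mul_smul]
      exact dist_triangle (k • g • μ) (k • ν) ρ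
    eq_of_dist_eq_zero := by
      intro s t hst
      obtain ⟨μ, rfl⟩ := Shape.mk_surjective s
      obtain ⟨ν, rfl⟩ := Shape.mk_surjective t
      obtain ⟨g, hg⟩ := h.exists_shapeDist_mk_eq μ ν
      rw [← Shape.mk_smul g μ]
      exact congrArg _ (eq_of_wassersteinDist_eq_zero hp (hg.symm.trans hst)) }

theorem continuous_shapeMk (hp : 1 ≤ p) (h : MinimizersExist p G) :
    @Continuous _ _ (wassersteinPseudoMetricSpace hp).toUniformSpace.toTopologicalSpace
      (shapeMetricSpace hp h).toUniformSpace.toTopologicalSpace (Shape.mk (p := p) G) := by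
  let _ : PseudoMetricSpace (FiniteMomentMeasure p X) := wassersteinPseudoMetricSpace hp
  let _ : MetricSpace (Shape p G) := shapeMetricSpace hp h
  refine (LipschitzWith.mk_one fun μ ν => ?_).continuous
  have := shapeDist_mk_le μ ν (1 : G)
  rwa [one_smul] at this

theorem separableSpace_shape (hp : 1 ≤ p) (h : MinimizersExist p G) :
    @SeparableSpace (Shape p G) (shapeMetricSpace hp h).toUniformSpace.toTopologicalSpace := by
  let _ : PseudoMetricSpace (FiniteMomentMeasure p X) := wassersteinPseudoMetricSpace hp
  let _ : MetricSpace (Shape p G) := shapeMetricSpace hp h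
  have : SeparableSpace (FiniteMomentMeasure p X) := separableSpace_wasserstein hp
  exact Shape.mk_surjective.denseRange.separableSpace (continuous_shapeMk hp h)

/-- Given a representative of one class, attainment provides a representative of the next at exactly
the shape distance. Fast Cauchy sequences therefore lift, and the limit of the lift projects to a
limit of the classes. -/
theorem completeSpace_shape (hp : 1 ≤ p) (h : MinimizersExist p G) :
    @CompleteSpace (Shape p G) (shapeMetricSpace hp h).toUniformSpace := by
  let _ : PseudoMetricSpace (FiniteMomentMeasure p X) := wassersteinPseudoMetricSpace hp
  let _ : MetricSpace (Shape p G) := shapeMetricSpace hp h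
  have : CompleteSpace (FiniteMomentMeasure p X) := completeSpace_wasserstein hp
  refine Metric.complete_of_convergent_controlled_sequences (fun n => 2⁻¹ ^ n)
    (fun n => by positivity) fun u hu => ?_
  have hstep (n : ℕ) (a : {μ // Shape.mk G μ = u n}) :
      ∃ b : {μ // Shape.mk G μ = u (n + 1)}, dist a.1 b.1 ≤ 1 * 2⁻¹ ^ n := by
    obtain ⟨μ, hμ⟩ := a
    obtain ⟨ν, hν⟩ := Shape.mk_surjective (u (n + 1))
    obtain ⟨g, hg⟩ := h.exists_shapeDist_mk_eq ν μ
    refine ⟨⟨g • ν, by rw [Shape.mk_smul, hν]⟩, ?_⟩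
    rw [hμ, hν] at hg
    rw [one_mul, dist_comm]
    exact hg.symm.le.trans (hu n (n + 1) n n.le_succ le_rfl).le
  choose next hnext using hstep
  obtain ⟨μ₀, hμ₀⟩ := Shape.mk_surjective (u 0)
  let v (n : ℕ) : {μ // Shape.mk G μ = u n} := Nat.rec ⟨μ₀, hμ₀⟩ next n
  have hv : CauchySeq fun n => (v n).1 :=
    cauchySeq_of_le_geometric 2⁻¹ 1 (by norm_num) fun n => hnext n (v n)
  obtain ⟨μ, hμ⟩ := cauchySeq_tendsto_of_complete hv
  refine ⟨Shape.mk G μ, (((continuous_shapeMk hp h).tendsto μ).comp hμ).congr fun n => ?_⟩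
  exact (v n).2

end Shape

/-! ### Existence of minimizers for proper actions -/

section ProperAction

/-- Pointwise convergence of isometries on a dense set implies pointwise convergence. -/
theorem tendsto_apply_of_denseRange {ι X : Type*} [MetricSpace X] {l : Filter ι} {g : ι → X ≃ᵢ X}
    {g₀ : X ≃ᵢ X} {e : ℕ → X} (he : DenseRange e)
    (h : ∀ k, Tendsto (fun n => g n (e k)) l (𝓝 (g₀ (e k))))
    (x : X) : Tendsto (fun n => g n x) l (𝓝 (g₀ x)) := by
  refine Metric.tendsto_nhds.2 fun ε hε => ?_
  obtain ⟨k, hk⟩ := he.exists_dist_lt x (ε := ε / 3) (by positivity)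
  filter_upwards [Metric.tendsto_nhds.1 (h k) (ε / 3) (by positivity)] with n hn
  have h1 := dist_triangle4 (g n x) (g n (e k)) (g₀ (e k)) (g₀ x)
  rw [(g n).dist_eq, g₀.dist_eq, dist_comm (e k) x] at h1
  linarith

variable {X : Type*} [MetricSpace X] [SecondCountableTopology X] [MeasurableSpace X]
  [BorelSpace X] {p : ℕ}

/-- The push-forwards under pointwise convergent isometries converge in Wasserstein distance. -/
theorem tendsto_wassersteinEDist_map (hp : 1 ≤ p) (μ : FiniteMomentMeasure p X)
    {g : ℕ → X ≃ᵢ X} {g₀ : X ≃ᵢ X} (h : ∀ x, Tendsto (fun n => g n x) atTop (𝓝 (g₀ x))) (x₀ : X)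
    {R : ℝ≥0∞} (hR : R ≠ ∞) (hbound : ∀ n, edist (g n x₀) x₀ ≤ R) :
    Tendsto (fun n => wassersteinEDist p (g₀ • μ).toMeasure (g n • μ).toMeasure) atTop (𝓝 0) := by
  have hp0 : p ≠ 0 := by lia
  have hmeas (k : X ≃ᵢ X) : Measurable k := k.continuous.measurable
  have hmom : ∫⁻ x, edist x₀ x ^ (p : ℝ) ∂μ.toMeasure < ∞ := by
    simpa using (lpEDist_lt_top_iff hp _ _ _).1 (lpEDist_const_lt_top hp μ x₀)
  have hedist : Measurable fun x => edist x₀ x := measurable_const.edist measurable_id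
  have hp1 : (1 : ℝ) ≤ p := by exact_mod_cast hp
  have hmom2 := ENNReal.lintegral_rpow_add_lt_top_of_lintegral_rpow_lt_top
    hedist.aemeasurable hmom hmom hp1
  have hconst : ∫⁻ _, (R + edist x₀ (g₀ x₀)) ^ (p : ℝ) ∂μ.toMeasure < ∞ := by
    rw [lintegral_const, measure_univ, mul_one, ENNReal.rpow_natCast]
    exact ENNReal.pow_lt_top (ENNReal.add_lt_top.2 ⟨hR.lt_top, edist_lt_top _ _⟩)
  have hfin := ENNReal.lintegral_rpow_add_lt_top_of_lintegral_rpow_lt_top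
    (hedist.add hedist).aemeasurable hmom2 hconst hp1
  -- Passing through `g₀ x₀` and `g n x₀` bounds the integrand by the `p`-th power of `2 * edist x₀
  -- x` plus a constant, independently of `n`.
  have hint : Tendsto (fun n => ∫⁻ x, edist (g₀ x) (g n x) ^ p ∂μ.toMeasure) atTop (𝓝 0) := by
    have := tendsto_lintegral_of_dominated_convergence (μ := μ.toMeasure)
      (F := fun n x => edist (g₀ x) (g n x) ^ p) (f := fun _ => 0)
      (fun x => ((edist x₀ x + edist x₀ x) + (R + edist x₀ (g₀ x₀))) ^ p)
      (fun n => ((hmeas _).edist (hmeas _)).pow_const p)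
      (fun n => Eventually.of_forall fun x => pow_le_pow_left' ?_ p) (by simpa using hfin.ne)
      (Eventually.of_forall fun x => ?_)
    · simpa using this
    · calc edist (g₀ x) (g n x)
          ≤ edist (g₀ x) (g₀ x₀) + edist (g₀ x₀) (g n x₀) + edist (g n x₀) (g n x) :=
            edist_triangle4 _ _ _ _
        _ ≤ edist x₀ x + (R + edist x₀ (g₀ x₀)) + edist x₀ x := by
            rw [g₀.edist_eq, (g n).edist_eq, edist_comm x x₀]
            gcongr
            rw [edist_comm]
            exact (edist_triangle _ x₀ _).trans (by gcongr; exact hbound n)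
        _ = _ := by ring
    · have h1 := (tendsto_const_nhds (x := g₀ x)).edist (h x)
      have h2 := ((ENNReal.continuous_pow p).tendsto _).comp h1
      rwa [edist_self, zero_pow hp0] at h2
  have hroot := ((ENNReal.continuous_rpow_const (y := 1 / (p : ℝ))).tendsto _).comp hint
  rw [ENNReal.zero_rpow_of_pos (by positivity)] at hroot
  exact tendsto_of_tendsto_of_tendsto_of_le_of_le tendsto_const_nhds hroot (fun _ => zero_le)
    fun n => wassersteinEDist_map_le hp μ.toMeasure (hmeas _) (hmeas _)

variable [CompleteSpace X]

/-- The displacement of a point under an isometry is controlled by the Wasserstein distances of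
the measures. -/
theorem edist_apply_le (hp : 1 ≤ p) (μ ν : FiniteMomentMeasure p X) (g : X ≃ᵢ X) (x : X) :
    edist (g x) x ≤ lpEDist p μ.toMeasure (fun _ => x) id +
      (wassersteinEDist p (g • μ).toMeasure ν.toMeasure +
        lpEDist p ν.toMeasure (fun _ => x) id) := by
  have h1 : wassersteinEDist p (Measure.dirac (g x)) (g • μ).toMeasure ≤
      lpEDist p μ.toMeasure (fun _ => x) id := by
    have := wassersteinEDist_map_le hp μ.toMeasure (measurable_const (a := g x))
      g.continuous.measurable
    rw [Measure.map_const, measure_univ, one_smul] at this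
    refine this.trans (le_of_eq ?_)
    simp only [lpEDist, g.edist_eq, id]
  have h2 : wassersteinEDist p ν.toMeasure (Measure.dirac x) ≤
      lpEDist p ν.toMeasure (fun _ => x) id :=
    (wassersteinEDist_comm hp _ _).trans_le (wassersteinEDist_dirac_le hp _ x)
  -- The chain runs from the Dirac mass at `g x` through `g • μ` and `ν` to the Dirac mass at `x`.
  refine (edist_le_wassersteinEDist_dirac hp (g x) x).trans
    ((wassersteinEDist_triangle hp _ (g • μ).toMeasure _).trans (add_le_add h1 ?_))
  exact (wassersteinEDist_triangle hp _ ν.toMeasure _).trans (add_le_add le_rfl h2)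

theorem minimizersExist_of_properSMul [ProperSpace X] (hp : 1 ≤ p) (G : Subgroup (X ≃ᵢ X))
    [TopologicalSpace G] [ProperSMul G X] : MinimizersExist p G := by
  intro μ ν
  let _ : PseudoMetricSpace (FiniteMomentMeasure p X) := wassersteinPseudoMetricSpace hp
  obtain ⟨x₀, -⟩ := μ.hasFiniteMoment
  have : Nonempty X := ⟨x₀⟩
  let cost (g : G) : ℝ := wassersteinDist (g • μ) ν
  have hbdd : BddBelow (Set.range cost) :=
    ⟨0, by rintro _ ⟨g, rfl⟩; exact ENNReal.toReal_nonneg⟩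
  obtain ⟨c, -, hc, hcmem⟩ := exists_seq_tendsto_sInf (Set.range_nonempty cost) hbdd
  choose g hg using hcmem
  obtain rfl : (fun n => cost (g n)) = c := funext hg
  obtain ⟨B, hB⟩ := hc.bddAbove_range
  let R := lpEDist p μ.toMeasure (fun _ => x₀) id +
    (ENNReal.ofReal B + lpEDist p ν.toMeasure (fun _ => x₀) id)
  have hR : R ≠ ∞ := ENNReal.add_ne_top.2 ⟨(lpEDist_const_lt_top hp μ x₀).ne,
    ENNReal.add_ne_top.2 ⟨ENNReal.ofReal_ne_top, (lpEDist_const_lt_top hp ν x₀).ne⟩⟩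
  have hbound n : edist ((g n : X ≃ᵢ X) x₀) x₀ ≤ R := by
    refine (edist_apply_le hp μ ν (g n) x₀).trans ?_
    rw [← ofReal_wassersteinDist hp]
    exact add_le_add le_rfl (add_le_add (ENNReal.ofReal_le_ofReal (hB ⟨n, rfl⟩)) le_rfl)
  have hproper := ProperSMul.isProperMap_smul_pair (G := G) (X := X)
  have hcont : Continuous fun z : G × X => z.1 • z.2 := continuous_fst.comp hproper.continuous
  -- Closed balls are compact, so the pairs `(g n, x₀)` all lie in one compact subset of `G × X`.
  have hK := hproper.isCompact_preimage
    ((isCompact_closedBall x₀ R.toReal).prod (isCompact_singleton (x := x₀)))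
  obtain ⟨⟨g₀, y⟩, -, hclus⟩ := hK.exists_mapClusterPt (f := atTop) (u := fun n => (g n, x₀))
    (by
      refine tendsto_principal.2 (Eventually.of_forall fun n => ⟨?_, rfl⟩)
      rw [Metric.mem_closedBall]
      exact (dist_edist _ _).trans_le (ENNReal.toReal_mono hR (hbound n)))
  -- `G` need not be first countable, so a cluster point there gives no subsequence by itself. Its
  -- image in the metrizable space `ℕ → X` does, by evaluation on a dense sequence.
  let F : G × X → ℕ → X := fun z k => z.1 • denseSeq X k
  have hF : Continuous F := continuous_pi fun k =>
    hcont.comp (continuous_fst.prodMk continuous_const)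
  obtain ⟨φ, hφ, hlim⟩ := MapClusterPt.tendsto_subseq
    (hclus.continuousAt_comp hF.continuousAt)
  have hpt (x : X) : Tendsto (fun n => (g (φ n) : X ≃ᵢ X) x) atTop (𝓝 ((g₀ : X ≃ᵢ X) x)) :=
    tendsto_apply_of_denseRange (denseRange_denseSeq X) (fun k => tendsto_pi_nhds.1 hlim k) x
  have hW := tendsto_wassersteinEDist_map hp μ hpt x₀ hR fun n => hbound (φ n)
  have hW' : Tendsto (fun n => dist (g₀ • μ) (g (φ n) • μ)) atTop (𝓝 0) :=
    (ENNReal.tendsto_toReal ENNReal.zero_ne_top).comp hW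
  -- By the triangle inequality, `cost g₀` is at most the distance from `g₀ • μ` to `g (φ n) • μ`,
  -- which vanishes, plus a cost tending to the infimum.
  have hle : cost g₀ ≤ sInf (Set.range cost) := by
    have hsum := hW'.add (hc.comp hφ.tendsto_atTop)
    rw [zero_add] at hsum
    exact ge_of_tendsto' hsum fun n => dist_triangle (g₀ • μ) (g (φ n) • μ) ν
  exact ⟨g₀, fun k => hle.trans (csInf_le hbdd ⟨k, rfl⟩)⟩

end ProperAction

end ShapeSpace

theorem mainTheorem4 {X : Type*} [MetricSpace X] [CompleteSpace X]
    [TopologicalSpace.SeparableSpace X] [MeasurableSpace X] [BorelSpace X]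
    (p : ℕ) (hp : 1 ≤ p) (G : Subgroup (X ≃ᵢ X))
    (hG : (ProperSpace X ∧ ∃ _ : TopologicalSpace G, ProperSMul G X) ∨
      ShapeSpace.MinimizersExist p G) :
    ∃ _ : MetricSpace (ShapeSpace.Shape p G),
      (∀ s t : ShapeSpace.Shape p G, dist s t = ShapeSpace.shapeDist s t) ∧
      CompleteSpace (ShapeSpace.Shape p G) ∧
      TopologicalSpace.SeparableSpace (ShapeSpace.Shape p G) := by
  have : SecondCountableTopology X := UniformSpace.secondCountable_of_separable X
  have h : ShapeSpace.MinimizersExist p G := by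
    rcases hG with ⟨hX, hG, hproper⟩ | h
    · exact ShapeSpace.minimizersExist_of_properSMul hp G
    · exact h
  exact ⟨ShapeSpace.shapeMetricSpace hp h, fun _ _ => rfl, ShapeSpace.completeSpace_shape hp h,
    ShapeSpace.separableSpace_shape hp h⟩
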